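/- **Definitions.** For $a\in\{\pm\tfrac12\}$ and $s\in\{0,1,2,\dots\}$ let $\mathsf J_s^{(a,-1/2)}$ be the polynomials with $$\mathsf J_s^{(1/2,-1/2)}\Big(\tfrac{z+z^{-1}}2\Big)=\frac{z^{s+1/2}-z^{-s-1/2}}{z^{1/2}-z^{-1/2}},\qquad \mathsf J_s^{(-1/2,-1/2)}\Big(\tfrac{z+z^{-1}}2\Big)=\frac{z^s+z^{-s}}2 ,$$ and let $W^{(1/2,-1/2)}(s)=1$ for all $s$, $W^{(-1/2,-1/2)}(0)=1$, $W^{(-1/2,-1/2)}(s)=2$ for $s>0$. For $\alpha\ge 0$ put $\phi_\alpha(x)=\big(1+\alpha(1-x)+\tfrac{\alpha^2}{2}(1-x)\big)^{-1}$. For integers $n,r_1,r_2,s_1,s_2\ge 0$ and $a_1,a_2\in\{\pm\frac12\}$ define $$\begin{aligned}K(r_1,a_1,s_1;r_2,a_2,s_2)={}&1_{2r_1+a_1\ge 2r_2+a_2}\frac{W^{(a_1,-1/2)}(s_1)}{\pi}\int_{-1}^1\mathsf J_{s_1}^{(a_1,-1/2)}(x)\mathsf J_{s_2}^{(a_2,-1/2)}(x)(x-1)^{r_1-r_2}(1-x)^{a_1}(1+x)^{-1/2}dx\\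 &+\frac{W^{(a_1,-1/2)}(s_1)}{\pi}\frac1{2\pi i}\int_{-1}^1\oint_C\frac{\phi_\alpha(x)^n}{\phi_\alpha(u)^n}\mathsf J_{s_1}^{(a_1,-1/2)}(x)\mathsf J_{s_2}^{(a_2,-1/2)}(u)\frac{(x-1)^{r_1}}{(u-1)^{r_2}}\frac{(1-x)^{a_1}(1+x)^{-1/2}}{x-u}\,du\,dx ,\end{aligned}$$ where $C$ is a positively oriented simple loop around $[-1,1]$, for instance $|u|=2$. For $-1<u<1$ and integers $r_1,r_2$ the discrete Jacobi kernel is $$L(r_1,a_1,s_1,r_2,a_2,s_2;u)=\begin{cases}\displaystyle\ \ \frac{W^{(a_1,-1/2)}(s_1)}{\pi}\int_u^1 g(x)\,dx,&2r_1+a_1\ge 2r_2+a_2,\\[2mm]\displaystyle-\frac{W^{(a_1,-1/2)}(s_1)}{\pi}\int_{-1}^u g(x)\,dx,&2r_1+a_1<2r_2+a_2,\end{cases}$$ $$g(x)=\mathsf J_{s_1}^{(a_1,-1/2)}(x)\,\mathsf J_{s_2}^{(a_2,-1/2)}(x)\,(x-1)^{r_1-r_2}(1-x)^{a_1}(1+x)^{-1/2}.$$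 It depends on $r_1,r_2$ only through $r_1-r_2$. **Theorem.** Let $\alpha\ge0$ and $t,l>0$. Let $n=n(N)$ be nonnegative integers with $n/N\to t$ as $N\to\infty$. Let $r_1,\dots,r_m$ be nonnegative integers depending on $N$ with $r_i/N\to l$ for every $i$, such that the differences $r_i-r_j$ do not depend on $N$. Fix $a_1,\dots,a_m\in\{\pm\frac12\}$ and integers $s_1,\dots,s_m\ge0$. 1. If $l\ge(1-(1+\alpha)^{-2})t$ and the triples $(r_i,a_i,s_i)$, $1\le i\le m$, are pairwise distinct, then $$\lim_{N\to\infty}\det\big[K(r_i,a_i,s_i;r_j,a_j,s_j)\big]_{i,j=1}^m=1 .$$ 2. If $l<(1-(1+\alpha)^{-2})t$, then $\theta=1+\dfrac{2l}{(l-t)(2\alpha+\alpha^2)}$ lies in $(-1,1)$ and $$\lim_{N\to\infty}\det\big[K(r_i,a_i,s_i;r_j,a_j,s_j)\big]_{i,j=1}^m=\det\big[L(r_i,a_i,s_i,r_j,a_j,s_j;\theta)\big]_{i,j=1}^m .$$ -/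

import Mathlib

open Filter Topology

noncomputable section

namespace DiscreteJacobi

/-- The two admissible values `-1/2` and `1/2` of the parameter `a`. -/
inductive HalfSign : Type
  | negHalf : HalfSign
  | posHalf : HalfSign

/-- The real number `±1/2` itself. -/
def HalfSign.val : HalfSign → ℝ
  | .negHalf => -(1 / 2)
  | .posHalf => 1 / 2

/-- The normalized Jacobi polynomial `J_s^{(a,-1/2)}`, for `a = ±1/2`.  For `a = -1/2` it is the
Chebyshev polynomial `T_s`, for `a = 1/2` it is `U_s + U_{s-1}` (with `U_{-1} = 0`);
`jacobi_negHalf_eval` and `jacobi_posHalf_eval` below are the defining equations. -/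
def jacobi (R : Type*) [CommRing R] (a : HalfSign) (s : ℕ) : Polynomial R :=
  match a with
  | .negHalf => Polynomial.Chebyshev.T R (s : ℤ)
  | .posHalf => Polynomial.Chebyshev.U R (s : ℤ) + Polynomial.Chebyshev.U R ((s : ℤ) - 1)

/-- `J_s^{(-1/2,-1/2)}((z + z⁻¹)/2) = (z^s + z^{-s})/2`. -/
theorem jacobi_negHalf_eval (s : ℕ) (z : ℂ) (hz : z ≠ 0) :
    (jacobi ℂ .negHalf s).eval ((z + z⁻¹) / 2) = (z ^ s + (z ^ s)⁻¹) / 2 := by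
  have key : ∀ k : ℕ,
      (Polynomial.Chebyshev.T ℂ (k : ℤ)).eval ((z + z⁻¹) / 2) = (z ^ k + (z ^ k)⁻¹) / 2 ∧
      (Polynomial.Chebyshev.T ℂ ((k : ℤ) + 1)).eval ((z + z⁻¹) / 2)
        = (z ^ (k + 1) + (z ^ (k + 1))⁻¹) / 2 := by
    intro k
    induction k with
    | zero => constructor <;> simp
    | succ k ih =>
      obtain ⟨h0, h1⟩ := ih
      refine ⟨by exact_mod_cast h1, ?_⟩
      have e : (((k + 1 : ℕ) : ℤ) + 1) = (k : ℤ) + 2 := by push_cast; ring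
      rw [e, Polynomial.Chebyshev.T_add_two]
      simp only [Polynomial.eval_sub, Polynomial.eval_mul, Polynomial.eval_ofNat,
        Polynomial.eval_X, h0, h1]
      field_simp
      ring
  exact (key s).1

/-- `J_s^{(1/2,-1/2)}((z + z⁻¹)/2) = (z^{s+1/2} - z^{-s-1/2}) / (z^{1/2} - z^{-1/2})`, where
`w = z^{1/2}` is a square root of `z`. -/
theorem jacobi_posHalf_eval (s : ℕ) (w : ℂ) (hw : w ≠ 0) (hw' : w ^ 2 ≠ 1) :
    (jacobi ℂ .posHalf s).eval ((w ^ 2 + (w ^ 2)⁻¹) / 2)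
      = (w ^ (2 * s + 1) - (w ^ (2 * s + 1))⁻¹) / (w - w⁻¹) := by
  have hd : w - w⁻¹ ≠ 0 := by
    intro h
    apply hw'
    have h2 : w * (w - w⁻¹) = 0 := by rw [h, mul_zero]
    rw [mul_sub, mul_inv_cancel₀ hw] at h2
    rw [pow_two]
    exact sub_eq_zero.mp h2
  have hd2 : w ^ 2 - 1 ≠ 0 := sub_ne_zero.mpr hw'
  rw [eq_div_iff hd]
  have key : ∀ k : ℕ,
      (jacobi ℂ .posHalf k).eval ((w ^ 2 + (w ^ 2)⁻¹) / 2) * (w - w⁻¹)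
        = w ^ (2 * k + 1) - (w ^ (2 * k + 1))⁻¹ ∧
      (jacobi ℂ .posHalf (k + 1)).eval ((w ^ 2 + (w ^ 2)⁻¹) / 2) * (w - w⁻¹)
        = w ^ (2 * k + 3) - (w ^ (2 * k + 3))⁻¹ := by
    intro k
    induction k with
    | zero =>
      constructor
      · simp [jacobi]
      · simp [jacobi]
        field_simp
        ring
    | succ k ih =>
      obtain ⟨h0, h1⟩ := ih
      refine ⟨h1, ?_⟩
      have rec2 : jacobi ℂ .posHalf (k + 1 + 1)
          = 2 * Polynomial.X * jacobi ℂ .posHalf (k + 1) - jacobi ℂ .posHalf k := by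
        have a1 := Polynomial.Chebyshev.U_add_two ℂ (k : ℤ)
        have a2 := Polynomial.Chebyshev.U_add_two ℂ ((k : ℤ) - 1)
        have e1 : (((k + 1 + 1 : ℕ) : ℤ)) = (k : ℤ) + 2 := by push_cast; ring
        have e2 : (k : ℤ) + 2 - 1 = (k : ℤ) - 1 + 2 := by ring
        have e3 : (((k + 1 : ℕ) : ℤ)) = (k : ℤ) + 1 := by push_cast; ring
        have e4 : (k : ℤ) + 1 - 1 = (k : ℤ) - 1 + 1 := by ring
        simp only [jacobi]
        rw [e1, e2, e3, e4, a1, a2]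
        ring
      rw [rec2]
      simp only [Polynomial.eval_sub, Polynomial.eval_mul, Polynomial.eval_ofNat,
        Polynomial.eval_X]
      rw [sub_mul, mul_assoc, h1, h0]
      field_simp
      ring
  exact (key s).1

/-- The weight constant `W^{(a,-1/2)}(s)`. -/
def W (a : HalfSign) (s : ℕ) : ℝ :=
  match a with
  | .negHalf => if s = 0 then 1 else 2
  | .posHalf => 1

/-- The density `(1-x)^a (1+x)^{-1/2}` on `(-1,1)`. -/
def weight (a : HalfSign) (x : ℝ) : ℝ :=
  (1 - x) ^ a.val * (1 + x) ^ (-(1 / 2) : ℝ)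

/-- `φ_α(z) = (1 + α(1-z) + α²(1-z)/2)⁻¹`. -/
def phi (α : ℝ) (z : ℂ) : ℂ :=
  (1 + (α : ℂ) * (1 - z) + (α : ℂ) ^ 2 * (1 - z) / 2)⁻¹

/-- The integrand `J_{s₁}^{(a₁,-1/2)}(x) J_{s₂}^{(a₂,-1/2)}(x) (x-1)^{r₁-r₂} (1-x)^{a₁}(1+x)^{-1/2}`
common to the kernels. -/
def singleIntegrand (r₁ : ℤ) (a₁ : HalfSign) (s₁ : ℕ) (r₂ : ℤ) (a₂ : HalfSign) (s₂ : ℕ)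
    (x : ℝ) : ℝ :=
  (jacobi ℝ a₁ s₁).eval x * (jacobi ℝ a₂ s₂).eval x * (x - 1) ^ (r₁ - r₂) * weight a₁ x

/-- The integrand of the double integral in the correlation kernel. -/
def doubleIntegrand (α : ℝ) (n r₁ : ℕ) (a₁ : HalfSign) (s₁ r₂ : ℕ) (a₂ : HalfSign) (s₂ : ℕ)
    (x : ℝ) (u : ℂ) : ℂ :=
  phi α x ^ n / phi α u ^ n * (jacobi ℂ a₁ s₁).eval (x : ℂ) * (jacobi ℂ a₂ s₂).eval u
    * (((x : ℂ) - 1) ^ r₁ / (u - 1) ^ r₂) * (weight a₁ x : ℂ) / ((x : ℂ) - u)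

open scoped Classical in
/-- The correlation kernel `K(r₁,a₁,s₁;r₂,a₂,s₂)` at time `n`.  The contour, a positively oriented
simple loop around `[-1,1]`, is the circle `|u| = 2`; since `1/φ_α` is a polynomial, the only
singularities of the integrand in `u` are `x` and `1`, so every such loop gives the same value. -/
def K (α : ℝ) (n r₁ : ℕ) (a₁ : HalfSign) (s₁ r₂ : ℕ) (a₂ : HalfSign) (s₂ : ℕ) : ℂ :=
  (if 2 * (r₁ : ℝ) + a₁.val ≥ 2 * (r₂ : ℝ) + a₂.val then
    ((W a₁ s₁ / Real.pi * ∫ x in (-1 : ℝ)..1, singleIntegrand r₁ a₁ s₁ r₂ a₂ s₂ x : ℝ) : ℂ)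
   else 0)
  + (W a₁ s₁ / Real.pi : ℝ) * (1 / (2 * Real.pi * Complex.I)) *
    ∫ x in (-1 : ℝ)..1, ∮ u in C(0, 2), doubleIntegrand α n r₁ a₁ s₁ r₂ a₂ s₂ x u

open scoped Classical in
/-- The discrete Jacobi kernel `L(r₁,a₁,s₁,r₂,a₂,s₂;u)`, for `-1 < u < 1`. -/
def L (r₁ : ℤ) (a₁ : HalfSign) (s₁ : ℕ) (r₂ : ℤ) (a₂ : HalfSign) (s₂ : ℕ) (u : ℝ) : ℝ :=
  if 2 * (r₁ : ℝ) + a₁.val ≥ 2 * (r₂ : ℝ) + a₂.val then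
    W a₁ s₁ / Real.pi * ∫ x in u..1, singleIntegrand r₁ a₁ s₁ r₂ a₂ s₂ x
  else
    -(W a₁ s₁ / Real.pi * ∫ x in (-1 : ℝ)..u, singleIntegrand r₁ a₁ s₁ r₂ a₂ s₂ x)

/-- `θ = 1 + 2l / ((l-t)(2α+α²))`. -/
def theta (α t l : ℝ) : ℝ := 1 + 2 * l / ((l - t) * (2 * α + α ^ 2))

end DiscreteJacobi

end

namespace DiscreteJacobi

/-! Put c = α + α²/2, so that 1/φ_α(u) = 1 + c(1-u). Expanding φ_α(u)^{-n} and the second Jacobi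
polynomial in powers of 1-u reduces the contour integral to integrals of (1-u)^m/(x-u). For m ≥ 0
only the residue at x occurs; for m < 0 the residues at x and 1 cancel (`circleIntegral_zpow_div`).
The contour integral therefore truncates the expansion. After multiplication by φ_α(x)^n, the
coefficient of (1-x)^j is weighted by the probability that a binomial variable with n trials and
success probability p(x) = c(1-x)/(1+c(1-x)) is at least r₂-j (`circleIntegral_generating`, `K_eq`).

By the law of large numbers this weight tends to 1 where t p(x) > l and to 0 where t p(x) < l; p is
monotone, so the switch happens at a single point θ. A Markov bound absorbs the pole of
(x-1)^{r₁-r₂} at 1 (`exists_zpow_mul_binomTail_le`), and dominated convergence subtracts in the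
limit exactly the integral over [-1,θ], which gives L at θ (`tendsto_K`).

If l ≥ t p(-1), then θ is replaced by -1, where the matrix of L is block triangular with identity
diagonal blocks, by orthogonality (`det_L_neg_one`). -/

/-! ### Binomial tails: Markov and Chebyshev bounds -/

/-- The probability that a binomial variable with `n` trials and odds `z` is at least `k`. -/
noncomputable def binomTail (n k : ℕ) (z : ℝ) : ℝ :=
  (∑ i ∈ Finset.range (n + 1) with k ≤ i, (n.choose i : ℝ) * z ^ i) / (1 + z) ^ n

theorem sum_choose_mul_pow (n : ℕ) (z : ℝ) :
    ∑ i ∈ Finset.range (n + 1), (n.choose i : ℝ) * z ^ i = (1 + z) ^ n := by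
  rw [add_comm 1 z, add_pow]
  exact Finset.sum_congr rfl fun i _ => by simp [mul_comm]

theorem binomTail_nonneg (n k : ℕ) {z : ℝ} (hz : 0 ≤ z) : 0 ≤ binomTail n k z :=
  div_nonneg (Finset.sum_nonneg fun _ _ => by positivity) (by positivity)

theorem binomTail_eq_one_sub (n k : ℕ) {z : ℝ} (hz : 0 ≤ z) :
    binomTail n k z
      = 1 - (∑ i ∈ Finset.range (n + 1) with ¬ k ≤ i, (n.choose i : ℝ) * z ^ i) / (1 + z) ^ n := by
  have h := Finset.sum_filter_add_sum_filter_not (Finset.range (n + 1)) (fun i => k ≤ i)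
    (fun i => (n.choose i : ℝ) * z ^ i)
  rw [sum_choose_mul_pow] at h
  have hp : (1 + z) ^ n ≠ 0 := by positivity
  rw [binomTail, eq_sub_iff_add_eq, ← add_div, h, div_self hp]

theorem binomTail_le_one (n k : ℕ) {z : ℝ} (hz : 0 ≤ z) : binomTail n k z ≤ 1 := by
  rw [binomTail_eq_one_sub n k hz, sub_le_self_iff]
  exact div_nonneg (Finset.sum_nonneg fun _ _ => by positivity) (by positivity)

/-- The exponential Markov bound with parameter `1 / y`. -/
theorem binomTail_le_mul_pow (n k : ℕ) {c y : ℝ} (hc : 0 ≤ c) (hy : 0 < y) (hy1 : y ≤ 1) :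
    binomTail n k (c * y) ≤ (1 + c) ^ n * y ^ k := by
  have h1 : 1 ≤ (1 + c * y) ^ n := one_le_pow₀ (by nlinarith [mul_nonneg hc hy.le])
  refine (div_le_self (Finset.sum_nonneg fun _ _ => by positivity) h1).trans ?_
  rw [← sum_choose_mul_pow, Finset.sum_mul]
  calc ∑ i ∈ Finset.range (n + 1) with k ≤ i, (n.choose i : ℝ) * (c * y) ^ i
      ≤ ∑ i ∈ Finset.range (n + 1) with k ≤ i, (n.choose i : ℝ) * c ^ i * y ^ k := by
        refine Finset.sum_le_sum fun i hi => ?_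
        rw [mul_pow, ← mul_assoc]
        exact mul_le_mul_of_nonneg_left
          (pow_le_pow_of_le_one hy.le hy1 (Finset.mem_filter.1 hi).2) (by positivity)
    _ ≤ _ := Finset.sum_le_sum_of_subset_of_nonneg (Finset.filter_subset _ _)
        fun _ _ _ => by positivity

/-- The normalized weights are the Bernstein polynomials at the success probability z/(1+z). -/
theorem binom_variance (n : ℕ) {z : ℝ} (hz : 0 ≤ z) :
    (∑ i ∈ Finset.range (n + 1), (n * (z / (1 + z)) - i) ^ 2 * ((n.choose i : ℝ) * z ^ i))
      / (1 + z) ^ n = n * (z / (1 + z)) * (1 - z / (1 + z)) := by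
  have h := congrArg (Polynomial.eval (z / (1 + z))) (bernsteinPolynomial.variance ℝ n)
  simp only [Polynomial.eval_finsetSum, Polynomial.eval_mul, Polynomial.eval_pow,
    Polynomial.eval_sub, Polynomial.eval_natCast, Polynomial.eval_X, Polynomial.eval_one,
    nsmul_eq_mul, bernsteinPolynomial] at h
  rw [← h, Finset.sum_div]
  refine Finset.sum_congr rfl fun i hi => ?_
  have hi' : i ≤ n := Nat.lt_succ_iff.1 (Finset.mem_range.1 hi)
  have hz1 : 1 + z ≠ 0 := by positivity
  have e : 1 - z / (1 + z) = 1 / (1 + z) := by field_simp; ring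
  have e2 : (1 + z) ^ n = (1 + z) ^ i * (1 + z) ^ (n - i) := by rw [← pow_add]; congr 1; omega
  rw [e, e2, div_pow, div_pow, one_pow]
  field_simp

/-- Chebyshev's inequality, with the variance np(1-p) bounded by n. -/
theorem binom_deviation_le (n : ℕ) (P : ℕ → Prop) [DecidablePred P] {z δ : ℝ} (hz : 0 ≤ z)
    (hδ : δ ≠ 0) (hP : ∀ i, P i → δ ^ 2 ≤ (n * (z / (1 + z)) - i) ^ 2) :
    (∑ i ∈ Finset.range (n + 1) with P i, (n.choose i : ℝ) * z ^ i) / (1 + z) ^ n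
      ≤ n / δ ^ 2 := by
  have hd : 0 < δ ^ 2 := by positivity
  rw [le_div_iff₀ hd]
  have hq0 : 0 ≤ z / (1 + z) := by positivity
  have hq1 : z / (1 + z) ≤ 1 := by rw [div_le_one (by positivity)]; linarith
  calc _ = (∑ i ∈ Finset.range (n + 1) with P i, δ ^ 2 * ((n.choose i : ℝ) * z ^ i))
        / (1 + z) ^ n := by rw [← Finset.mul_sum]; ring
    _ ≤ (∑ i ∈ Finset.range (n + 1) with P i,
          (n * (z / (1 + z)) - i) ^ 2 * ((n.choose i : ℝ) * z ^ i)) / (1 + z) ^ n := by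
        refine div_le_div_of_nonneg_right (Finset.sum_le_sum fun i hi => ?_) (by positivity)
        exact mul_le_mul_of_nonneg_right (hP i (Finset.mem_filter.1 hi).2) (by positivity)
    _ ≤ (∑ i ∈ Finset.range (n + 1),
          (n * (z / (1 + z)) - i) ^ 2 * ((n.choose i : ℝ) * z ^ i)) / (1 + z) ^ n := by
        refine div_le_div_of_nonneg_right ?_ (by positivity)
        exact Finset.sum_le_sum_of_subset_of_nonneg (Finset.filter_subset _ _)
          fun _ _ _ => by positivity
    _ = n * (z / (1 + z)) * (1 - z / (1 + z)) := binom_variance n hz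
    _ ≤ n := by
        have : (z / (1 + z)) * (1 - z / (1 + z)) ≤ 1 := by nlinarith
        rw [mul_assoc]
        exact mul_le_of_le_one_right (Nat.cast_nonneg n) this

/-! ### Law of large numbers for the tails -/

section Limits

variable {n k : ℕ → ℕ} {t l : ℝ}

/-- The mean differs from the threshold by order N, so the Chebyshev bound is of order 1/N. -/
theorem tendsto_deviation_bound (hn : Tendsto (fun N : ℕ => (n N : ℝ) / (N : ℝ)) atTop (𝓝 t))
    (hk : Tendsto (fun N : ℕ => (k N : ℝ) / (N : ℝ)) atTop (𝓝 l)) {q : ℝ} (h : t * q ≠ l) :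
    Tendsto (fun N : ℕ => (n N : ℝ) / (n N * q - k N) ^ 2) atTop (𝓝 0) := by
  have h0 : t * q - l ≠ 0 := sub_ne_zero.2 h
  have h1 := (hn.div (((hn.mul_const q).sub hk).pow 2) (pow_ne_zero 2 h0)).mul
    (tendsto_one_div_atTop_nhds_zero_nat (𝕜 := ℝ))
  rw [mul_zero] at h1
  refine h1.congr' ?_
  filter_upwards [eventually_gt_atTop 0] with N hN
  have hN' : (N : ℝ) ≠ 0 := by positivity
  simp only [Pi.div_apply]
  have e : (n N : ℝ) / N * q - k N / N = (n N * q - k N) / N := by ring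
  rw [e, div_pow]
  by_cases hz : (n N * q - k N) = 0
  · simp [hz]
  field_simp

theorem tendsto_binomTail_zero (hn : Tendsto (fun N : ℕ => (n N : ℝ) / (N : ℝ)) atTop (𝓝 t))
    (hk : Tendsto (fun N : ℕ => (k N : ℝ) / (N : ℝ)) atTop (𝓝 l)) {z : ℝ} (hz : 0 ≤ z)
    (h : t * (z / (1 + z)) < l) :
    Tendsto (fun N : ℕ => binomTail (n N) (k N) z) atTop (𝓝 0) := by
  refine squeeze_zero' (Eventually.of_forall fun N => binomTail_nonneg _ _ hz) ?_
    (tendsto_deviation_bound hn hk h.ne)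
  filter_upwards [(hn.mul_const _).eventually_lt hk h, eventually_gt_atTop 0] with N hN hN0
  have hN' : (0 : ℝ) < N := by positivity
  have hlt : n N * (z / (1 + z)) < k N := by
    rw [div_mul_eq_mul_div, div_lt_div_iff_of_pos_right hN'] at hN
    exact hN
  refine binom_deviation_le (n N) (fun i => k N ≤ i) hz (sub_neg.2 hlt).ne fun i hi => ?_
  have : (k N : ℝ) ≤ i := by exact_mod_cast hi
  nlinarith

theorem tendsto_binomTail_one (hn : Tendsto (fun N : ℕ => (n N : ℝ) / (N : ℝ)) atTop (𝓝 t))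
    (hk : Tendsto (fun N : ℕ => (k N : ℝ) / (N : ℝ)) atTop (𝓝 l)) {z : ℝ} (hz : 0 ≤ z)
    (h : l < t * (z / (1 + z))) :
    Tendsto (fun N : ℕ => binomTail (n N) (k N) z) atTop (𝓝 1) := by
  simp only [binomTail_eq_one_sub _ _ hz]
  rw [show (𝓝 (1 : ℝ)) = 𝓝 (1 - 0) by simp]
  refine tendsto_const_nhds.sub ?_
  refine squeeze_zero' (Eventually.of_forall fun N =>
    div_nonneg (Finset.sum_nonneg fun _ _ => by positivity) (by positivity)) ?_
    (tendsto_deviation_bound hn hk h.ne')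
  filter_upwards [hk.eventually_lt (hn.mul_const _) h, eventually_gt_atTop 0] with N hN hN0
  have hN' : (0 : ℝ) < N := by positivity
  have hlt : k N < n N * (z / (1 + z)) := by
    rw [div_mul_eq_mul_div, div_lt_div_iff_of_pos_right hN'] at hN
    exact hN
  refine binom_deviation_le (n N) (fun i => ¬ k N ≤ i) hz (sub_pos.2 hlt).ne' fun i hi => ?_
  have : (i : ℝ) ≤ k N := by exact_mod_cast (not_le.1 hi).le
  nlinarith

/-- Near `y = 0` the binomial tail vanishes to every order, uniformly in the scaling limit. -/
theorem exists_zpow_mul_binomTail_le {c : ℝ} (hc : 0 ≤ c) (hl : 0 < l)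
    (hn : Tendsto (fun N : ℕ => (n N : ℝ) / (N : ℝ)) atTop (𝓝 t))
    (hk : Tendsto (fun N : ℕ => (k N : ℝ) / (N : ℝ)) atTop (𝓝 l)) (d : ℤ) :
    ∃ M : ℝ, 0 ≤ M ∧ ∀ᶠ N in atTop, ∀ y : ℝ, 0 < y → y ≤ 2 →
      y ^ d * binomTail (n N) (k N) (c * y) ≤ M := by
  obtain ⟨D, hD⟩ : ∃ D : ℕ, D = d.natAbs := ⟨_, rfl⟩
  -- choose `δ` with `(1 + c) ^ (t + 1) δ ^ (l / 2) ≤ 1`, in integer form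
  obtain ⟨A, hA⟩ := exists_nat_gt ((t + 1) / (l / 2))
  set δ : ℝ := ((1 + c) ^ A)⁻¹ with hδ
  have hc1 : 1 ≤ 1 + c := by linarith
  have hδ0 : 0 < δ := by positivity
  have hδ1 : δ ≤ 1 := inv_le_one_of_one_le₀ (one_le_pow₀ hc1)
  -- The three summands bound the cases d ≥ 0, d < 0 with y > δ, and d < 0 with y ≤ δ.
  refine ⟨2 ^ D + (δ⁻¹) ^ D + 1, by positivity, ?_⟩
  have hkN : Tendsto (fun N : ℕ => (k N : ℝ)) atTop atTop := by
    have := hk.pos_mul_atTop hl (tendsto_natCast_atTop_atTop (R := ℝ))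
    refine this.congr' ?_
    filter_upwards [eventually_gt_atTop 0] with N hN
    have : (N : ℝ) ≠ 0 := by positivity
    field_simp
  filter_upwards [hn.eventually_lt_const (lt_add_one t),
    (hk.sub ((tendsto_const_div_atTop_nhds_zero_nat (D : ℝ)))).eventually_const_lt
      (show l / 2 < l - 0 by linarith), eventually_gt_atTop 0,
    hkN.eventually_ge_atTop (D : ℝ)] with N h1 h2 hN h3 y hy hy2
  have hN' : (0 : ℝ) < N := by positivity
  have hDk : D ≤ k N := by exact_mod_cast h3
  have hT0 := binomTail_nonneg (n N) (k N) (mul_nonneg hc hy.le)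
  have hT1 := binomTail_le_one (n N) (k N) (mul_nonneg hc hy.le)
  rcases le_or_gt 0 d with hd | hd
  · lift d to ℕ using hd
    simp only [Int.natAbs_natCast] at hD
    subst hD
    rw [zpow_natCast]
    have : y ^ D ≤ 2 ^ D := pow_le_pow_left₀ hy.le hy2 D
    have h5 : y ^ D * binomTail (n N) (k N) (c * y) ≤ y ^ D :=
      mul_le_of_le_one_right (by positivity) hT1
    have : 0 ≤ (δ⁻¹) ^ D := by positivity
    linarith
  · have e : d = -(D : ℤ) := by omega
    rw [e, zpow_neg, zpow_natCast, ← inv_pow]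
    rcases le_or_gt y δ with hyδ | hyδ
    · have hb := binomTail_le_mul_pow (n N) (k N) hc hy (hyδ.trans hδ1)
      -- Eventually n < (t+1)N and k - D > (l/2)N. The choice of A then lets the decay δ^(k-D) pay
      -- for the growth (1+c)^n, even after D powers of y are spent on the pole.
      have hnA : n N ≤ A * (k N - D) := by
        have h6 : (n N : ℝ) ≤ A * ((k N : ℝ) - D) := by
          rw [div_lt_iff₀ hN'] at h1
          rw [← sub_div, lt_div_iff₀ hN'] at h2
          rw [div_lt_iff₀ (by positivity)] at hA
          have hA0 : (0 : ℝ) ≤ A := Nat.cast_nonneg A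
          nlinarith [mul_le_mul_of_nonneg_left h2.le hA0,
            mul_le_mul_of_nonneg_right hA.le hN'.le]
        rw [← Nat.cast_sub hDk] at h6
        exact_mod_cast h6
      have h7 : (1 + c) ^ n N * y ^ (k N - D) ≤ 1 := by
        calc (1 + c) ^ n N * y ^ (k N - D)
            ≤ (1 + c) ^ (A * (k N - D)) * δ ^ (k N - D) := by gcongr
          _ = 1 := by
              rw [pow_mul, ← mul_pow, hδ, mul_inv_cancel₀ (by positivity), one_pow]
      have h8 : y⁻¹ ^ D * y ^ k N = y ^ (k N - D) := by
        rw [inv_pow, pow_sub₀ _ hy.ne' hDk, mul_comm]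
      have h9 : y⁻¹ ^ D * binomTail (n N) (k N) (c * y) ≤ 1 := by
        calc _ ≤ y⁻¹ ^ D * ((1 + c) ^ n N * y ^ k N) := by gcongr
          _ = (1 + c) ^ n N * y ^ (k N - D) := by rw [← h8]; ring
          _ ≤ 1 := h7
      have : 0 ≤ (δ⁻¹) ^ D := by positivity
      have : (0 : ℝ) ≤ 2 ^ D := by positivity
      linarith
    · have h5 : y⁻¹ ^ D * binomTail (n N) (k N) (c * y) ≤ y⁻¹ ^ D :=
        mul_le_of_le_one_right (by positivity) hT1
      have : y⁻¹ ^ D ≤ δ⁻¹ ^ D := by gcongr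
      have : (0 : ℝ) ≤ 2 ^ D := by positivity
      linarith

end Limits

/-! ### Contour integrals of powers of 1-u against 1/(x-u) -/

theorem circle_ne {u w : ℂ} (hu : u ∈ Metric.sphere (0 : ℂ) 2) (hw : w ∈ Metric.ball (0 : ℂ) 2) :
    w - u ≠ 0 := by
  intro h
  rw [sub_eq_zero] at h
  subst h
  simp only [mem_sphere_iff_norm, sub_zero, Metric.mem_ball, dist_zero_right] at hu hw
  linarith

theorem one_mem_ball_two : (1 : ℂ) ∈ Metric.ball (0 : ℂ) 2 := by simp

theorem circleIntegrable_zpow_div {x : ℂ} (hx : x ∈ Metric.ball (0 : ℂ) 2) (m : ℤ) :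
    CircleIntegrable (fun u => (1 - u) ^ m / (x - u)) 0 2 := by
  refine ContinuousOn.circleIntegrable (by norm_num) ?_
  refine ContinuousOn.div (ContinuousOn.zpow₀ (by fun_prop) m fun u hu =>
    Or.inl (circle_ne hu one_mem_ball_two)) (by fun_prop) fun u hu => circle_ne hu hx

theorem circleIntegral_one_sub_zpow {m : ℤ} (hm : m ≠ -1) :
    ∮ u in C(0, 2), (1 - u) ^ m = 0 := by
  have h : ∀ u : ℂ, (1 - u) ^ m = (-1) ^ m * (u - 1) ^ m := fun u => by
    rw [← mul_zpow]; congr 1; ring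
  simp only [h, circleIntegral.integral_const_mul, circleIntegral.integral_sub_zpow_of_ne hm,
    mul_zero]

theorem circleIntegral_natPow_div {x : ℂ} (hx : x ∈ Metric.ball (0 : ℂ) 2) (k : ℕ) :
    ∮ u in C(0, 2), (1 - u) ^ k / (x - u) = -(2 * Real.pi * Complex.I) * (1 - x) ^ k := by
  have h := DifferentiableOn.circleIntegral_sub_inv_smul (R := 2) (c := 0) (w := x)
    (f := fun u : ℂ => -(1 - u) ^ k) (by fun_prop) hx
  rw [smul_eq_mul] at h
  rw [neg_mul, ← mul_neg, ← h]
  congr 1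
  ext u
  rw [smul_eq_mul, ← neg_sub u x, div_neg, div_eq_mul_inv]
  ring

/-- Comes from 1-x = (1-u) - (x-u); it lowers the exponent step by step without residues at a
higher-order pole. -/
theorem circleIntegral_zpow_div_rec {x : ℂ} (hx : x ∈ Metric.ball (0 : ℂ) 2) (m : ℤ) :
    (1 - x) * ∮ u in C(0, 2), (1 - u) ^ m / (x - u)
      = (∮ u in C(0, 2), (1 - u) ^ (m + 1) / (x - u)) - ∮ u in C(0, 2), (1 - u) ^ m := by
  rw [← circleIntegral.integral_const_mul, ← circleIntegral.integral_sub
    (circleIntegrable_zpow_div hx _)]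
  · refine circleIntegral.integral_congr (by norm_num) fun u hu => ?_
    have h1 := circle_ne hu one_mem_ball_two
    have h2 := circle_ne hu hx
    rw [zpow_add_one₀ h1]
    field_simp
    ring
  · exact ContinuousOn.circleIntegrable (by norm_num) (ContinuousOn.zpow₀ (by fun_prop) m
      fun u hu => Or.inl (circle_ne hu one_mem_ball_two))

/-- The residues at x and at 1 cancel. In the recursion only the exponent -1 sees a nonzero integral
of (1-u)^m, which offsets the Cauchy value for exponent 0. -/
theorem circleIntegral_negPow_div {x : ℂ} (hx : x ∈ Metric.ball (0 : ℂ) 2) (hx1 : x ≠ 1) (k : ℕ) :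
    ∮ u in C(0, 2), (1 - u) ^ (-(k : ℤ) - 1) / (x - u) = 0 := by
  have hx1' : 1 - x ≠ 0 := sub_ne_zero.2 hx1.symm
  induction k with
  | zero =>
    have h := circleIntegral_zpow_div_rec hx (-1)
    have h0 := circleIntegral_natPow_div hx 0
    have h1 : ∮ u in C(0, 2), ((1 : ℂ) - u) ^ (-1 : ℤ) = -(2 * Real.pi * Complex.I) := by
      rw [← circleIntegral.integral_sub_inv_of_mem_ball one_mem_ball_two,
        neg_eq_neg_one_mul (∮ u in C(0, 2), (u - (1 : ℂ))⁻¹),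
        ← circleIntegral.integral_const_mul]
      congr 1
      ext u
      rw [zpow_neg_one, ← neg_sub u 1, inv_neg, neg_one_mul]
    simp only [neg_add_cancel, zpow_zero, pow_zero, mul_one] at h h0
    rw [h0, h1, sub_self] at h
    simpa using (mul_eq_zero.1 h).resolve_left hx1'
  | succ k ih =>
    have h := circleIntegral_zpow_div_rec hx (-((k + 1 : ℕ) : ℤ) - 1)
    rw [circleIntegral_one_sub_zpow (by push_cast; omega), sub_zero,
      show -((k + 1 : ℕ) : ℤ) - 1 + 1 = -(k : ℤ) - 1 by push_cast; ring, ih] at h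
    exact (mul_eq_zero.1 h).resolve_left hx1'

theorem circleIntegral_zpow_div {x : ℂ} (hx : x ∈ Metric.ball (0 : ℂ) 2) (hx1 : x ≠ 1) (m : ℤ) :
    ∮ u in C(0, 2), (1 - u) ^ m / (x - u)
      = if 0 ≤ m then -(2 * Real.pi * Complex.I) * (1 - x) ^ m else 0 := by
  split_ifs with h
  · lift m to ℕ using h
    simpa using circleIntegral_natPow_div hx m
  · obtain ⟨k, rfl⟩ : ∃ k : ℕ, m = -(k : ℤ) - 1 := ⟨(-m - 1).toNat, by omega⟩
    exact circleIntegral_negPow_div hx hx1 k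

/-! ### Residue evaluation as a sum of binomial tails -/

/-- The coefficients of a polynomial in powers of `1 - x`. -/
noncomputable def reflCoeff (p : Polynomial ℝ) (j : ℕ) : ℝ := (p.comp (1 - Polynomial.X)).coeff j

/-- The size of the expansion in powers of `1 - x`. -/
noncomputable def reflSize (p : Polynomial ℝ) : ℕ := (p.comp (1 - Polynomial.X)).natDegree + 1

theorem eval_eq_sum_reflCoeff (p : Polynomial ℝ) (x : ℝ) :
    p.eval x = ∑ j ∈ Finset.range (reflSize p), reflCoeff p j * (1 - x) ^ j := by
  have h := Polynomial.eval_eq_sum_range (p := p.comp (1 - Polynomial.X)) (1 - x)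
  simpa [Polynomial.eval_comp, reflSize, reflCoeff] using h

theorem eval_map_eq_sum_reflCoeff (p : Polynomial ℝ) (u : ℂ) :
    (p.map Complex.ofRealHom).eval u
      = ∑ j ∈ Finset.range (reflSize p), (reflCoeff p j : ℂ) * (1 - u) ^ j := by
  have h := Polynomial.eval₂_eq_sum_range (p := p.comp (1 - Polynomial.X)) Complex.ofRealHom (1 - u)
  simpa [Polynomial.eval₂_comp, Polynomial.eval_map, reflSize, reflCoeff] using h

/-- The expansion of a polynomial in powers of `1 - x`, weighted by binomial tails. -/
noncomputable def tailSum (p : Polynomial ℝ) (n r : ℕ) (c x : ℝ) : ℝ :=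
  ∑ j ∈ Finset.range (reflSize p),
    reflCoeff p j * (1 - x) ^ j * binomTail n (r - j) (c * (1 - x))

/-- The term with index i from the n-th power and j from the polynomial carries exponent i+j-r and
survives exactly when i ≥ r-j. The survivors sum to a binomial tail times its normalization
(1+c(1-x))^n. -/
theorem circleIntegral_generating (p : Polynomial ℝ) (n r : ℕ) {c x : ℝ} (hc : 0 ≤ c)
    (hx : x ∈ Set.Ioo (-1 : ℝ) 1) :
    ∮ u in C(0, 2), (1 + (c : ℂ) * (1 - u)) ^ n * (p.map Complex.ofRealHom).eval u
        / (u - 1) ^ r / ((x : ℂ) - u)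
      = -(2 * Real.pi * Complex.I)
        * (((1 + c * (1 - x)) ^ n * tailSum p n r c x / (x - 1) ^ r : ℝ) : ℂ) := by
  have hxb : (x : ℂ) ∈ Metric.ball (0 : ℂ) 2 := by
    simp only [Metric.mem_ball, dist_zero_right, Complex.norm_real, Real.norm_eq_abs]
    rw [abs_lt]; constructor <;> linarith [hx.1, hx.2]
  have hx1 : (x : ℂ) ≠ 1 := by exact_mod_cast hx.2.ne
  have hx1' : (1 : ℂ) - x ≠ 0 := sub_ne_zero.2 hx1.symm
  have hy : 0 < 1 - x := by linarith [hx.2]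
  have hexp : ∀ u ∈ Metric.sphere (0 : ℂ) 2,
      (1 + (c : ℂ) * (1 - u)) ^ n * (p.map Complex.ofRealHom).eval u / (u - 1) ^ r / ((x : ℂ) - u)
      = ∑ j ∈ Finset.range (reflSize p), ∑ i ∈ Finset.range (n + 1),
        ((-1) ^ r * (reflCoeff p j : ℂ) * (n.choose i : ℂ) * (c : ℂ) ^ i)
          * ((1 - u) ^ ((i : ℤ) + j - r) / ((x : ℂ) - u)) := by
    intro u hu
    have h1 := circle_ne hu one_mem_ball_two
    have h2 := circle_ne hu hxb
    have e1 : (1 + (c : ℂ) * (1 - u)) ^ n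
        = ∑ i ∈ Finset.range (n + 1), (n.choose i : ℂ) * (c : ℂ) ^ i * (1 - u) ^ i := by
      rw [add_comm 1 _, add_pow]
      refine Finset.sum_congr rfl fun i _ => ?_
      rw [one_pow, mul_pow]; ring
    have e2 : (u - 1) ^ r = (-1) ^ r * (1 - u) ^ r := by rw [← mul_pow]; congr 1; ring
    rw [e1, eval_map_eq_sum_reflCoeff, Finset.sum_mul_sum, Finset.sum_comm, Finset.sum_div,
      Finset.sum_div]
    refine Finset.sum_congr rfl fun j _ => ?_
    rw [Finset.sum_div, Finset.sum_div]
    refine Finset.sum_congr rfl fun i _ => ?_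
    rw [zpow_sub₀ h1, zpow_add₀ h1, zpow_natCast, zpow_natCast, zpow_natCast, e2]
    have e3 : ((-1 : ℂ) ^ r) * (-1) ^ r = 1 := by rw [← mul_pow]; simp
    have e4 : ((-1 : ℂ) ^ r)⁻¹ = (-1) ^ r := (eq_inv_of_mul_eq_one_left e3).symm
    simp only [div_eq_mul_inv, mul_inv, e4]
    ring
  rw [circleIntegral.integral_congr (by norm_num) hexp]
  have hint : ∀ (j i : ℕ), CircleIntegrable (fun u : ℂ =>
      ((-1) ^ r * (reflCoeff p j : ℂ) * (n.choose i : ℂ) * (c : ℂ) ^ i)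
          * ((1 - u) ^ ((i : ℤ) + j - r) / ((x : ℂ) - u))) 0 2 := fun j i =>
    (circleIntegrable_zpow_div hxb _).const_mul _
  rw [circleIntegral.integral_fun_sum fun j _ => CircleIntegrable.fun_sum _ fun i _ => hint j i]
  simp only [circleIntegral.integral_fun_sum fun i _ => hint _ i,
    circleIntegral.integral_const_mul, circleIntegral_zpow_div hxb hx1]
  have hpos : (1 + c * (1 - x)) ^ n ≠ 0 := by positivity
  rw [tailSum, Finset.mul_sum, Finset.sum_div]
  push_cast
  rw [Finset.mul_sum]
  refine Finset.sum_congr rfl fun j _ => ?_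
  have e5 : binomTail n (r - j) (c * (1 - x)) * (1 + c * (1 - x)) ^ n
      = ∑ i ∈ Finset.range (n + 1), if r - j ≤ i then (n.choose i : ℝ) * (c * (1 - x)) ^ i else 0 := by
    rw [binomTail, div_mul_cancel₀ _ hpos, Finset.sum_filter]
  have e6 := congrArg (fun v : ℝ => (v : ℂ)) e5
  push_cast at e6
  have e7 : (1 + (c : ℂ) * (1 - x)) ^ n * ((reflCoeff p j : ℂ) * (1 - (x : ℂ)) ^ j
        * (binomTail n (r - j) (c * (1 - x)) : ℂ))
      = (reflCoeff p j : ℂ) * (1 - (x : ℂ)) ^ j * ∑ i ∈ Finset.range (n + 1),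
        (((if r - j ≤ i then (n.choose i : ℝ) * (c * (1 - x)) ^ i else 0 : ℝ)) : ℂ) := by
    rw [← e6]; ring
  rw [e7, Finset.mul_sum, Finset.sum_div, Finset.mul_sum]
  refine Finset.sum_congr rfl fun i _ => ?_
  have e2 : ((x : ℂ) - 1) ^ r = (-1) ^ r * (1 - x) ^ r := by rw [← mul_pow]; congr 1; ring
  have e3 : ((-1 : ℂ) ^ r) * (-1) ^ r = 1 := by rw [← mul_pow]; simp
  have e4 : ((-1 : ℂ) ^ r)⁻¹ = (-1) ^ r := (eq_inv_of_mul_eq_one_left e3).symm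
  by_cases hij : r - j ≤ i
  -- For j > r the natural-number difference r-j is 0, which still encodes i+j ≥ r.
  · rw [if_pos (by omega), if_pos hij, zpow_sub₀ hx1', zpow_add₀ hx1', zpow_natCast, zpow_natCast,
      zpow_natCast, e2]
    push_cast
    simp only [div_eq_mul_inv, mul_inv, e4, mul_pow]
    ring
  · rw [if_neg (by omega), if_neg hij]
    simp

/-! ### The kernel as a difference of real integrals -/

theorem jacobi_map (a : HalfSign) (s : ℕ) :
    (jacobi ℝ a s).map Complex.ofRealHom = jacobi ℂ a s := by
  cases a <;> simp [jacobi]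

theorem jacobi_eval_ofReal (a : HalfSign) (s : ℕ) (x : ℝ) :
    (jacobi ℂ a s).eval (x : ℂ) = (((jacobi ℝ a s).eval x : ℝ) : ℂ) := by
  rw [← jacobi_map, Polynomial.eval_map]
  exact Polynomial.eval₂_at_apply Complex.ofRealHom x

theorem ae_ne_right (b : ℝ) : ∀ᵐ x : ℝ, x ≠ b := by
  simpa using (Set.countable_singleton b).ae_notMem MeasureTheory.volume

/-- The integrand left over after the contour integral has been evaluated by residues. -/
noncomputable def tailIntegrand (c : ℝ) (n r : ℕ) (d : ℤ) (a : HalfSign) (p q : Polynomial ℝ)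
    (x : ℝ) : ℝ :=
  p.eval x * tailSum q n r c x * (x - 1) ^ d * weight a x

theorem circleIntegral_doubleIntegrand {α : ℝ} (hα : 0 ≤ α) (n r₁ : ℕ) (a₁ : HalfSign)
    (s₁ r₂ : ℕ) (a₂ : HalfSign) (s₂ : ℕ) {x : ℝ} (hx : x ∈ Set.Ioo (-1 : ℝ) 1) :
    ∮ u in C(0, 2), doubleIntegrand α n r₁ a₁ s₁ r₂ a₂ s₂ x u
      = -(2 * Real.pi * Complex.I) * ((tailIntegrand (α + α ^ 2 / 2) n r₂ (r₁ - r₂) a₁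
          (jacobi ℝ a₁ s₁) (jacobi ℝ a₂ s₂) x : ℝ) : ℂ) := by
  have hc : 0 ≤ α + α ^ 2 / 2 := by positivity
  have hphi : ∀ u : ℂ, phi α u = (1 + ((α + α ^ 2 / 2 : ℝ) : ℂ) * (1 - u))⁻¹ := fun u => by
    rw [phi]; push_cast; congr 1; ring
  have h : ∀ u : ℂ, doubleIntegrand α n r₁ a₁ s₁ r₂ a₂ s₂ x u
      = (phi α x ^ n * (jacobi ℂ a₁ s₁).eval (x : ℂ) * ((x : ℂ) - 1) ^ r₁ * (weight a₁ x : ℂ))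
        * ((1 + ((α + α ^ 2 / 2 : ℝ) : ℂ) * (1 - u)) ^ n
          * ((jacobi ℝ a₂ s₂).map Complex.ofRealHom).eval u / (u - 1) ^ r₂ / ((x : ℂ) - u)) := by
    intro u
    rw [doubleIntegrand, hphi u, jacobi_map, inv_pow]
    simp only [div_eq_mul_inv, inv_inv]
    ring
  simp only [h, circleIntegral.integral_const_mul]
  rw [circleIntegral_generating _ n r₂ hc hx, hphi, jacobi_eval_ofReal, tailIntegrand]
  generalize tailSum (jacobi ℝ a₂ s₂) n r₂ (α + α ^ 2 / 2) x = S
  have hy : 0 < 1 - x := by linarith [hx.2]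
  have hx1 : x - 1 ≠ 0 := by linarith
  have hpos : 1 + (α + α ^ 2 / 2) * (1 - x) ≠ 0 := by positivity
  rw [zpow_sub₀ hx1, zpow_natCast, zpow_natCast]
  have hpos' : (1 : ℂ) + ((α : ℂ) + (α : ℂ) ^ 2 / 2) * (1 - (x : ℂ)) ≠ 0 := by exact_mod_cast hpos
  push_cast
  generalize (1 : ℂ) + ((α : ℂ) + (α : ℂ) ^ 2 / 2) * (1 - (x : ℂ)) = E at hpos' ⊢
  rw [inv_pow]
  field_simp

/-- The prefactor 1/(2πi) meets the residue factor -2πi, hence the minus sign; the contour integral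
is needed only for almost every x, so x = 1 may be dropped. -/
theorem K_eq {α : ℝ} (hα : 0 ≤ α) (n r₁ : ℕ) (a₁ : HalfSign) (s₁ r₂ : ℕ) (a₂ : HalfSign)
    (s₂ : ℕ) :
    K α n r₁ a₁ s₁ r₂ a₂ s₂ = (((if 2 * (r₁ : ℝ) + a₁.val ≥ 2 * (r₂ : ℝ) + a₂.val then
        W a₁ s₁ / Real.pi * ∫ x in (-1 : ℝ)..1, singleIntegrand r₁ a₁ s₁ r₂ a₂ s₂ x else 0)
      - W a₁ s₁ / Real.pi * ∫ x in (-1 : ℝ)..1, tailIntegrand (α + α ^ 2 / 2) n r₂ (r₁ - r₂) a₁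
          (jacobi ℝ a₁ s₁) (jacobi ℝ a₂ s₂) x : ℝ) : ℂ) := by
  have h : ∫ x in (-1 : ℝ)..1, ∮ u in C(0, 2), doubleIntegrand α n r₁ a₁ s₁ r₂ a₂ s₂ x u
      = -(2 * Real.pi * Complex.I) * ((∫ x in (-1 : ℝ)..1, tailIntegrand (α + α ^ 2 / 2) n r₂
          (r₁ - r₂) a₁ (jacobi ℝ a₁ s₁) (jacobi ℝ a₂ s₂) x : ℝ) : ℂ) := by
    rw [← intervalIntegral.integral_ofReal, ← intervalIntegral.integral_const_mul]
    refine intervalIntegral.integral_congr_ae ?_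
    filter_upwards [ae_ne_right 1] with x hx1 hx
    rw [Set.uIoc_of_le (by norm_num)] at hx
    exact circleIntegral_doubleIntegrand hα n r₁ a₁ s₁ r₂ a₂ s₂ ⟨hx.1, lt_of_le_of_ne hx.2 hx1⟩
  have hpi : (2 * Real.pi * Complex.I : ℂ) ≠ 0 := Complex.two_pi_I_ne_zero
  rw [K, h, Complex.ofReal_sub, sub_eq_add_neg (Complex.ofReal _)]
  congr 1
  · split_ifs <;> simp
  · rw [mul_assoc, ← mul_assoc (1 / _), mul_neg, one_div, inv_mul_cancel₀ hpi]
    push_cast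
    ring

/-! ### Weights and orthogonality -/

theorem weight_negHalf {x : ℝ} (hx : x ∈ Set.Icc (-1 : ℝ) 1) :
    weight .negHalf x = √(1 - x ^ 2)⁻¹ := by
  have h1 : 0 ≤ 1 - x := by linarith [hx.2]
  have h2 : 0 ≤ 1 + x := by linarith [hx.1]
  rw [weight, HalfSign.val, ← Real.mul_rpow h1 h2, Real.sqrt_inv, Real.sqrt_eq_rpow,
    ← Real.rpow_neg (by nlinarith)]
  congr 1
  ring

theorem weight_posHalf {x : ℝ} (hx : x ∈ Set.Icc (-1 : ℝ) 1) :
    weight .posHalf x = (1 - x) * √(1 - x ^ 2)⁻¹ := by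
  rw [← weight_negHalf hx, weight, weight, HalfSign.val, HalfSign.val, ← mul_assoc]
  congr 1
  rcases eq_or_lt_of_le (show 0 ≤ 1 - x by linarith [hx.2]) with h | h
  · rw [← h, Real.zero_rpow (by norm_num), zero_mul]
  · nth_rewrite 2 [← Real.rpow_one (1 - x)]
    rw [← Real.rpow_add h]
    norm_num

theorem uIoc_subset_Icc : Set.uIoc (-1 : ℝ) 1 ⊆ Set.Icc (-1) 1 := by
  rw [Set.uIoc_of_le (by norm_num)]
  exact Set.Ioc_subset_Icc_self

theorem intervalIntegrable_weight (a : HalfSign) :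
    IntervalIntegrable (weight a) MeasureTheory.volume (-1) 1 := by
  have h := Polynomial.Chebyshev.intervalIntegrable_sqrt_one_sub_sq_inv
  cases a
  · exact h.congr fun x hx => (weight_negHalf (uIoc_subset_Icc hx)).symm
  · have h2 : IntervalIntegrable (fun x : ℝ => (1 - x) * √(1 - x ^ 2)⁻¹) MeasureTheory.volume
        (-1) 1 := h.continuousOn_mul (by fun_prop)
    exact h2.congr fun x hx => (weight_posHalf (uIoc_subset_Icc hx)).symm

theorem one_sub_X_mul_jacobi_posHalf (s : ℕ) :
    (1 - Polynomial.X) * jacobi ℝ .posHalf s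
      = Polynomial.Chebyshev.T ℝ s - Polynomial.Chebyshev.T ℝ (s + 1) := by
  rw [jacobi, Polynomial.Chebyshev.T_eq_U_sub_X_mul_U, Polynomial.Chebyshev.T_eq_U_sub_X_mul_U,
    Polynomial.Chebyshev.U_add_one, add_sub_cancel_right]
  ring

/-- With x = cos φ this is 2 sin((s+1/2)φ) sin((t+1/2)φ) = cos((s-t)φ) - cos((s+t+1)φ), since 1-x =
2 sin²(φ/2). -/
theorem one_sub_X_mul_jacobi_posHalf_mul (s t : ℕ) :
    (1 - Polynomial.X) * (jacobi ℝ .posHalf s * jacobi ℝ .posHalf t)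
      = Polynomial.Chebyshev.T ℝ (s - t) - Polynomial.Chebyshev.T ℝ (s + t + 1) := by
  have hX : (2 * (1 - Polynomial.X) : Polynomial ℝ) ≠ 0 := by
    intro h
    have := congrArg (Polynomial.eval 0) h
    simp at this
  -- The extra factor 2(1-X) turns each Jacobi factor into a difference of Chebyshev polynomials,
  -- whose products linearize.
  refine mul_left_cancel₀ hX ?_
  have e : 2 * (1 - Polynomial.X) * ((1 - Polynomial.X) *
        (jacobi ℝ .posHalf s * jacobi ℝ .posHalf t))
      = 2 * ((1 - Polynomial.X) * jacobi ℝ .posHalf s)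
        * ((1 - Polynomial.X) * jacobi ℝ .posHalf t) := by ring
  rw [e, one_sub_X_mul_jacobi_posHalf, one_sub_X_mul_jacobi_posHalf]
  have h1 := Polynomial.Chebyshev.T_mul_T ℝ s t
  have h2 := Polynomial.Chebyshev.T_mul_T ℝ s (t + 1)
  have h3 := Polynomial.Chebyshev.T_mul_T ℝ (s + 1) t
  have h4 := Polynomial.Chebyshev.T_mul_T ℝ (s + 1) (t + 1)
  have h5 := Polynomial.Chebyshev.T_add_one ℝ ((s : ℤ) - t)
  have h6 := Polynomial.Chebyshev.T_add_one ℝ ((s : ℤ) + t + 1)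
  rw [show (s : ℤ) - (t + 1) = s - t - 1 by ring, show (s : ℤ) + (t + 1) = s + t + 1 by ring] at h2
  rw [show (s : ℤ) + 1 + t = s + t + 1 by ring, show (s : ℤ) + 1 - t = s - t + 1 by ring] at h3
  rw [show (s : ℤ) + 1 + (t + 1) = s + t + 1 + 1 by ring,
    show (s : ℤ) + 1 - (t + 1) = s - t by ring] at h4
  rw [add_sub_cancel_right] at h6
  linear_combination h1 - h2 - h3 + h4 - h5 + h6

/-- Both cases reduce to the Chebyshev measure. For a = 1/2 the weight supplies the factor 1-x that
linearizes the product, and s₁+s₂+1 is never 0, so only T of index s₁-s₂ can contribute. -/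
theorem integral_jacobi_mul_jacobi (a : HalfSign) (s₁ s₂ : ℕ) :
    W a s₁ / Real.pi
        * ∫ x in (-1 : ℝ)..1, (jacobi ℝ a s₁).eval x * (jacobi ℝ a s₂).eval x * weight a x
      = if s₁ = s₂ then 1 else 0 := by
  have hpi := Real.pi_ne_zero
  cases a
  · have h : ∫ x in (-1 : ℝ)..1, (jacobi ℝ .negHalf s₁).eval x * (jacobi ℝ .negHalf s₂).eval x
        * weight .negHalf x = ∫ x, (Polynomial.Chebyshev.T ℝ s₁).eval x
          * (Polynomial.Chebyshev.T ℝ s₂).eval x ∂Polynomial.Chebyshev.measureT := by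
      rw [Polynomial.Chebyshev.integral_measureT]
      refine intervalIntegral.integral_congr fun x hx => ?_
      rw [Set.uIcc_of_le (by norm_num)] at hx
      simp only [weight_negHalf hx, jacobi]
    rw [h]
    split_ifs with hs
    · subst hs
      by_cases h0 : s₁ = 0
      · subst h0
        have := Polynomial.Chebyshev.integral_eval_T_real_mul_self_measureT_zero
        rw [Nat.cast_zero, this]
        simp [W, hpi]
      · rw [Polynomial.Chebyshev.integral_T_real_mul_self_measureT_of_ne_zero h0]
        simp only [W, if_neg h0]
        field_simp
    · rw [Polynomial.Chebyshev.integral_eval_T_real_mul_eval_T_real_measureT_of_ne hs, mul_zero]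
  · have h : ∫ x in (-1 : ℝ)..1, (jacobi ℝ .posHalf s₁).eval x * (jacobi ℝ .posHalf s₂).eval x
        * weight .posHalf x = ∫ x, ((Polynomial.Chebyshev.T ℝ (s₁ - s₂)).eval x
          - (Polynomial.Chebyshev.T ℝ (s₁ + s₂ + 1)).eval x) ∂Polynomial.Chebyshev.measureT := by
      rw [Polynomial.Chebyshev.integral_measureT]
      refine intervalIntegral.integral_congr fun x hx => ?_
      rw [Set.uIcc_of_le (by norm_num)] at hx
      have e := congrArg (Polynomial.eval x) (one_sub_X_mul_jacobi_posHalf_mul s₁ s₂)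
      simp only [Polynomial.eval_mul, Polynomial.eval_sub, Polynomial.eval_one,
        Polynomial.eval_X] at e
      simp only [weight_posHalf hx, ← e]
      ring
    rw [h, MeasureTheory.integral_sub
      (Polynomial.Chebyshev.integrable_measureT (Polynomial.continuous _).continuousOn)
      (Polynomial.Chebyshev.integrable_measureT (Polynomial.continuous _).continuousOn),
      Polynomial.Chebyshev.integral_eval_T_real_measureT_of_ne_zero
        (show (s₁ : ℤ) + s₂ + 1 ≠ 0 by omega), sub_zero]
    split_ifs with hs
    · subst hs
      rw [sub_self, Polynomial.Chebyshev.integral_eval_T_real_measureT_zero]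
      simp [W, hpi]
    · rw [Polynomial.Chebyshev.integral_eval_T_real_measureT_of_ne_zero (by omega), mul_zero]

/-! ### The limiting determinant at the endpoint -1 -/

theorem HalfSign.eq_of_level_eq {d₁ d₂ : ℤ} {a₁ a₂ : HalfSign}
    (h : 2 * (d₁ : ℝ) + a₁.val = 2 * (d₂ : ℝ) + a₂.val) : d₁ = d₂ ∧ a₁ = a₂ := by
  cases a₁ <;> cases a₂ <;> simp only [HalfSign.val] at h <;> simp
  · exact_mod_cast (by linarith : (d₁ : ℝ) = d₂)
  · have h' : (2 * d₁ : ℝ) = 2 * d₂ + 1 := by linarith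
    have : 2 * d₁ = 2 * d₂ + 1 := by exact_mod_cast h'
    omega
  · have h' : (2 * d₁ + 1 : ℝ) = 2 * d₂ := by linarith
    have : 2 * d₁ + 1 = 2 * d₂ := by exact_mod_cast h'
    omega
  · exact_mod_cast (by linarith : (d₁ : ℝ) = d₂)

/-- At -1 the lower branch of L integrates over a point and vanishes, which gives triangularity in
the level 2d+a. Within one level d and a agree, so orthonormality makes the block an identity
matrix; injectivity separates its indices. -/
theorem det_L_neg_one {m : ℕ} (d : Fin m → ℤ) (a : Fin m → HalfSign) (s : Fin m → ℕ)
    (hinj : Function.Injective fun i => (d i, a i, s i)) :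
    (Matrix.of fun i j : Fin m => L (d i) (a i) (s i) (d j) (a j) (s j) (-1)).det = 1 := by
  classical
  have htri : (Matrix.of fun i j : Fin m =>
      L (d i) (a i) (s i) (d j) (a j) (s j) (-1)).BlockTriangular
        -- The sign makes the vanishing entries, those with row level below column level, match the
        -- convention of `Matrix.BlockTriangular`.
        fun i => -(2 * (d i : ℝ) + (a i).val) := by
    intro i j hij
    rw [Matrix.of_apply, L, if_neg (by simp only at hij; linarith), intervalIntegral.integral_same,
      mul_zero, neg_zero]
  rw [htri.det]
  refine Finset.prod_eq_one fun b _ => ?_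
  refine (congrArg Matrix.det ?_).trans Matrix.det_one
  ext ⟨i, hi⟩ ⟨j, hj⟩
  obtain ⟨hd, ha⟩ := HalfSign.eq_of_level_eq (neg_injective (hi.trans hj.symm))
  rw [Matrix.toSquareBlock_def, Matrix.of_apply, Matrix.of_apply, hd, ha, L, if_pos le_rfl]
  simp only [singleIntegrand, sub_self, zpow_zero, mul_one, integral_jacobi_mul_jacobi,
    Matrix.one_apply, Subtype.mk.injEq]
  refine if_congr ⟨fun hs => hinj ?_, fun h => h ▸ rfl⟩ rfl rfl
  simp only [hd, ha, hs]

/-! ### Dominated convergence for the tail integrals -/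

theorem measurable_tailIntegrand (c : ℝ) (n r : ℕ) (d : ℤ) (a : HalfSign) (p q : Polynomial ℝ) :
    Measurable (tailIntegrand c n r d a p q) := by
  have h : ∀ (f : ℝ → ℝ), Measurable f → Measurable fun x => f x ^ d := fun f hf => hf.pow_const d
  have hd := h (fun x => x - 1) (by fun_prop)
  have hT : ∀ k, Measurable fun x : ℝ => binomTail n k (c * (1 - x)) := fun k => by
    unfold binomTail
    fun_prop
  have hS : Measurable (tailSum q n r c) := by
    unfold tailSum
    fun_prop
  have hw : Measurable (weight a) := by
    unfold weight
    fun_prop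
  unfold tailIntegrand
  exact ((p.continuous.measurable.mul hS).mul hd).mul hw

section Limits

variable {n r : ℕ → ℕ} {t l : ℝ}

theorem tendsto_sub_div (hr : Tendsto (fun N : ℕ => (r N : ℝ) / (N : ℝ)) atTop (𝓝 l)) (j : ℕ) :
    Tendsto (fun N : ℕ => ((r N - j : ℕ) : ℝ) / (N : ℝ)) atTop (𝓝 l) := by
  have h := hr.sub (tendsto_const_div_atTop_nhds_zero_nat (j : ℝ))
  rw [sub_zero] at h
  refine tendsto_of_tendsto_of_tendsto_of_le_of_le h hr (fun N => ?_) fun N => ?_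
  · simp only
    rw [← sub_div]
    refine div_le_div_of_nonneg_right ?_ (Nat.cast_nonneg N)
    rw [sub_le_iff_le_add]
    exact_mod_cast (by omega : r N ≤ r N - j + j)
  · exact div_le_div_of_nonneg_right (Nat.cast_le.2 (Nat.sub_le _ _)) (Nat.cast_nonneg N)

theorem tendsto_tailSum (hn : Tendsto (fun N : ℕ => (n N : ℝ) / (N : ℝ)) atTop (𝓝 t))
    (hr : Tendsto (fun N : ℕ => (r N : ℝ) / (N : ℝ)) atTop (𝓝 l)) {c x : ℝ} (hc : 0 ≤ c)
    (hx : x ≤ 1) (q : Polynomial ℝ) (h : l < t * (c * (1 - x) / (1 + c * (1 - x)))) :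
    Tendsto (fun N => tailSum q (n N) (r N) c x) atTop (𝓝 (q.eval x)) := by
  rw [eval_eq_sum_reflCoeff]
  refine tendsto_finsetSum _ fun j _ => ?_
  simpa using (tendsto_binomTail_one hn (tendsto_sub_div hr j)
    (mul_nonneg hc (sub_nonneg.2 hx)) h).const_mul (reflCoeff q j * (1 - x) ^ j)

theorem tendsto_tailSum_zero (hn : Tendsto (fun N : ℕ => (n N : ℝ) / (N : ℝ)) atTop (𝓝 t))
    (hr : Tendsto (fun N : ℕ => (r N : ℝ) / (N : ℝ)) atTop (𝓝 l)) {c x : ℝ} (hc : 0 ≤ c)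
    (hx : x ≤ 1) (q : Polynomial ℝ) (h : t * (c * (1 - x) / (1 + c * (1 - x))) < l) :
    Tendsto (fun N => tailSum q (n N) (r N) c x) atTop (𝓝 0) := by
  rw [show (0 : ℝ) = ∑ j ∈ Finset.range (reflSize q), 0 by simp]
  refine tendsto_finsetSum _ fun j _ => ?_
  simpa using (tendsto_binomTail_zero hn (tendsto_sub_div hr j)
    (mul_nonneg hc (sub_nonneg.2 hx)) h).const_mul (reflCoeff q j * (1 - x) ^ j)

/-- Supplies the integrable majorant: for d < 0 the pole at 1 is cancelled by the smallness of each
binomial tail there. -/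
theorem exists_tailIntegrand_bound (hl : 0 < l)
    (hn : Tendsto (fun N : ℕ => (n N : ℝ) / (N : ℝ)) atTop (𝓝 t))
    (hr : Tendsto (fun N : ℕ => (r N : ℝ) / (N : ℝ)) atTop (𝓝 l)) {c : ℝ} (hc : 0 ≤ c)
    (d : ℤ) (a : HalfSign) (p q : Polynomial ℝ) :
    ∃ B : ℝ, ∀ᶠ N in atTop, ∀ x ∈ Set.Ioo (-1 : ℝ) 1,
      ‖tailIntegrand c (n N) (r N) d a p q x‖ ≤ B * weight a x := by
  obtain ⟨Bp, hBp⟩ := (isCompact_Icc (a := (-1 : ℝ)) (b := 1)).exists_bound_of_continuousOn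
    p.continuous.continuousOn
  choose M hM0 hM using fun j : ℕ =>
    exists_zpow_mul_binomTail_le hc hl hn (tendsto_sub_div hr j) d
  refine ⟨Bp * ∑ j ∈ Finset.range (reflSize q), |reflCoeff q j| * 2 ^ j * M j, ?_⟩
  filter_upwards [(Filter.eventually_all_finset (Finset.range (reflSize q))).2
    fun j _ => hM j] with N hN x hx
  have hy : 0 < 1 - x := by linarith [hx.2]
  have hy2 : 1 - x ≤ 2 := by linarith [hx.1]
  have hw : 0 ≤ weight a x :=
    mul_nonneg (Real.rpow_nonneg hy.le _) (Real.rpow_nonneg (by linarith [hx.1]) _)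
  have hp := hBp x (Set.Ioo_subset_Icc_self hx)
  have habs : |x - 1| = 1 - x := by rw [abs_sub_comm, abs_of_pos hy]
  have hS : |tailSum q (n N) (r N) c x * (x - 1) ^ d|
      ≤ ∑ j ∈ Finset.range (reflSize q), |reflCoeff q j| * 2 ^ j * M j := by
    rw [tailSum, Finset.sum_mul]
    refine (Finset.abs_sum_le_sum_abs _ _).trans (Finset.sum_le_sum fun j hj => ?_)
    have hT := binomTail_nonneg (n N) (r N - j) (mul_nonneg hc hy.le)
    rw [abs_mul, abs_mul, abs_mul, abs_zpow, habs, abs_of_nonneg hT, abs_of_pos (pow_pos hy j),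
      mul_assoc _ (binomTail _ _ _), mul_comm (binomTail _ _ _)]
    have h1 := hN j hj (1 - x) hy hy2
    have h2 : (1 - x) ^ j ≤ 2 ^ j := pow_le_pow_left₀ hy.le hy2 j
    have h3 : 0 ≤ (1 - x) ^ d * binomTail (n N) (r N - j) (c * (1 - x)) :=
      mul_nonneg (zpow_nonneg hy.le d) hT
    gcongr
  rw [tailIntegrand, mul_assoc (p.eval x), norm_mul, norm_mul, Real.norm_of_nonneg hw]
  refine mul_le_mul_of_nonneg_right ?_ hw
  exact mul_le_mul hp hS (abs_nonneg _) ((norm_nonneg _).trans hp)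

/-- The tails converge to the indicator of x < θ off the null set {θ, 1}, so nothing is required at
the critical point. -/
theorem tendsto_integral_tailIntegrand (hl : 0 < l)
    (hn : Tendsto (fun N : ℕ => (n N : ℝ) / (N : ℝ)) atTop (𝓝 t))
    (hr : Tendsto (fun N : ℕ => (r N : ℝ) / (N : ℝ)) atTop (𝓝 l)) {c : ℝ} (hc : 0 ≤ c)
    (d : ℤ) (a : HalfSign) (p q : Polynomial ℝ) {θ : ℝ} (hθ : θ ∈ Set.Icc (-1 : ℝ) 1)
    (hlt : ∀ x ∈ Set.Ioo (-1 : ℝ) 1, x < θ → l < t * (c * (1 - x) / (1 + c * (1 - x))))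
    (hgt : ∀ x ∈ Set.Ioo (-1 : ℝ) 1, θ < x → t * (c * (1 - x) / (1 + c * (1 - x))) < l) :
    Tendsto (fun N => ∫ x in (-1 : ℝ)..1, tailIntegrand c (n N) (r N) d a p q x) atTop
      (𝓝 (∫ x in (-1 : ℝ)..θ, p.eval x * q.eval x * (x - 1) ^ d * weight a x)) := by
  obtain ⟨B, hB⟩ := exists_tailIntegrand_bound hl hn hr hc d a p q
  rw [← intervalIntegral.integral_indicator hθ]
  refine intervalIntegral.tendsto_integral_filter_of_dominated_convergence
    (fun x => B * weight a x)
    (Eventually.of_forall fun N => (measurable_tailIntegrand _ _ _ _ _ _ _).aestronglyMeasurable)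
    ?_ ((intervalIntegrable_weight a).const_mul B) ?_
  · filter_upwards [hB] with N hN
    filter_upwards [ae_ne_right 1] with x hx1 hx
    rw [Set.uIoc_of_le (by norm_num)] at hx
    exact hN x ⟨hx.1, lt_of_le_of_ne hx.2 hx1⟩
  · filter_upwards [ae_ne_right 1, ae_ne_right θ] with x hx1 hxθ hx
    rw [Set.uIoc_of_le (by norm_num)] at hx
    have hx' : x ∈ Set.Ioo (-1 : ℝ) 1 := ⟨hx.1, lt_of_le_of_ne hx.2 hx1⟩
    rcases lt_or_gt_of_ne hxθ with h | h
    · simp only [tailIntegrand]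
      rw [Set.indicator_of_mem (show x ∈ {x | x ≤ θ} from h.le)]
      exact (((tendsto_tailSum hn hr hc hx.2 q (hlt x hx' h)).const_mul _).mul_const _).mul_const _
    · rw [Set.indicator_of_notMem (show x ∉ {x | x ≤ θ} from not_le.2 h)]
      simpa [tailIntegrand] using ((((tendsto_tailSum_zero hn hr hc hx.2 q (hgt x hx' h)).const_mul
        (p.eval x)).mul_const ((x - 1) ^ d)).mul_const (weight a x))

end Limits

/-! ### Convergence of the kernel and of its determinants -/

theorem intervalIntegrable_singleIntegrand {r₁ r₂ : ℤ} (h : r₂ ≤ r₁) (a₁ a₂ : HalfSign)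
    (s₁ s₂ : ℕ) :
    IntervalIntegrable (singleIntegrand r₁ a₁ s₁ r₂ a₂ s₂) MeasureTheory.volume (-1) 1 := by
  obtain ⟨k, hk⟩ : ∃ k : ℕ, r₁ - r₂ = k := ⟨(r₁ - r₂).toNat, by omega⟩
  unfold singleIntegrand
  rw [hk]
  simp only [zpow_natCast]
  exact (intervalIntegrable_weight a₁).continuousOn_mul
    (((Polynomial.continuous _).mul (Polynomial.continuous _)).mul (by fun_prop)).continuousOn

theorem le_of_level_le {r₁ r₂ : ℤ} {a₁ a₂ : HalfSign}
    (h : 2 * (r₂ : ℝ) + a₂.val ≤ 2 * (r₁ : ℝ) + a₁.val) : r₂ ≤ r₁ := by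
  have h' : (2 * r₂ : ℝ) ≤ 2 * r₁ + 1 := by
    cases a₁ <;> cases a₂ <;> simp only [HalfSign.val] at h <;> linarith
  have : 2 * r₂ ≤ 2 * r₁ + 1 := by exact_mod_cast h'
  omega

/-- Entrywise convergence of the correlation kernel, for a limiting density which fills the part of
the interval to the left of `θ`. -/
theorem tendsto_K {α t l : ℝ} (hα : 0 ≤ α) (hl : 0 < l) {n r₁ r₂ : ℕ → ℕ}
    (hn : Tendsto (fun N : ℕ => (n N : ℝ) / (N : ℝ)) atTop (𝓝 t))
    (hr : Tendsto (fun N : ℕ => (r₂ N : ℝ) / (N : ℝ)) atTop (𝓝 l)) {d₁ d₂ : ℤ}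
    (hd : ∀ N, (r₁ N : ℤ) - r₂ N = d₁ - d₂) (a₁ a₂ : HalfSign) (s₁ s₂ : ℕ)
    {θ : ℝ} (hθ : θ ∈ Set.Icc (-1 : ℝ) 1)
    (hlt : ∀ x ∈ Set.Ioo (-1 : ℝ) 1, x < θ →
      l < t * ((α + α ^ 2 / 2) * (1 - x) / (1 + (α + α ^ 2 / 2) * (1 - x))))
    (hgt : ∀ x ∈ Set.Ioo (-1 : ℝ) 1, θ < x →
      t * ((α + α ^ 2 / 2) * (1 - x) / (1 + (α + α ^ 2 / 2) * (1 - x))) < l) :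
    Tendsto (fun N => K α (n N) (r₁ N) a₁ s₁ (r₂ N) a₂ s₂) atTop
      (𝓝 ((L d₁ a₁ s₁ d₂ a₂ s₂ θ : ℝ) : ℂ)) := by
  have hc : 0 ≤ α + α ^ 2 / 2 := by positivity
  have h := tendsto_integral_tailIntegrand hl hn hr hc (d₁ - d₂) a₁ (jacobi ℝ a₁ s₁)
    (jacobi ℝ a₂ s₂) hθ hlt hgt
  have hK : ∀ N, K α (n N) (r₁ N) a₁ s₁ (r₂ N) a₂ s₂
      = (((if 2 * (d₁ : ℝ) + a₁.val ≥ 2 * (d₂ : ℝ) + a₂.val then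
        W a₁ s₁ / Real.pi * ∫ x in (-1 : ℝ)..1, singleIntegrand d₁ a₁ s₁ d₂ a₂ s₂ x else 0)
      - W a₁ s₁ / Real.pi * ∫ x in (-1 : ℝ)..1, tailIntegrand (α + α ^ 2 / 2) (n N) (r₂ N)
          (d₁ - d₂) a₁ (jacobi ℝ a₁ s₁) (jacobi ℝ a₂ s₂) x : ℝ) : ℂ) := by
    intro N
    have hN : (r₁ N : ℝ) - r₂ N = d₁ - d₂ := by exact_mod_cast hd N
    rw [K_eq hα, hd N]
    simp only [singleIntegrand, hd N]
    congr 3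
    simp only [eq_iff_iff]
    constructor <;> intro h <;> linarith
  simp only [hK]
  refine (Complex.continuous_ofReal.tendsto _).comp ?_
  have hlim : L d₁ a₁ s₁ d₂ a₂ s₂ θ = (if 2 * (d₁ : ℝ) + a₁.val ≥ 2 * (d₂ : ℝ) + a₂.val then
        W a₁ s₁ / Real.pi * ∫ x in (-1 : ℝ)..1, singleIntegrand d₁ a₁ s₁ d₂ a₂ s₂ x else 0)
      - W a₁ s₁ / Real.pi * ∫ x in (-1 : ℝ)..θ, singleIntegrand d₁ a₁ s₁ d₂ a₂ s₂ x := by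
    rw [L]
    split_ifs with hlev
    -- In this branch r₁ ≥ r₂, so there is no pole at 1 and the integral over [-1,1] may be split at
    -- θ.
    · have hint := intervalIntegrable_singleIntegrand (le_of_level_le hlev) a₁ a₂ s₁ s₂
      rw [← mul_sub, intervalIntegral.integral_interval_sub_left hint
        (hint.mono_set (Set.uIcc_subset_uIcc_left ?_))]
      rwa [Set.uIcc_of_le (by norm_num)]
    · rw [zero_sub]
  rw [hlim]
  exact tendsto_const_nhds.sub (h.const_mul _)

theorem tendsto_det_K {α t l : ℝ} (hα : 0 ≤ α) (hl : 0 < l) {n : ℕ → ℕ}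
    (hn : Tendsto (fun N : ℕ => (n N : ℝ) / (N : ℝ)) atTop (𝓝 t)) {m : ℕ} {r : ℕ → Fin m → ℕ}
    (hr : ∀ i, Tendsto (fun N : ℕ => (r N i : ℝ) / (N : ℝ)) atTop (𝓝 l)) {d : Fin m → ℤ}
    (hd : ∀ N i j, (r N i : ℤ) - (r N j : ℤ) = d i - d j) (a : Fin m → HalfSign) (s : Fin m → ℕ)
    {θ : ℝ} (hθ : θ ∈ Set.Icc (-1 : ℝ) 1)
    (hlt : ∀ x ∈ Set.Ioo (-1 : ℝ) 1, x < θ →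
      l < t * ((α + α ^ 2 / 2) * (1 - x) / (1 + (α + α ^ 2 / 2) * (1 - x))))
    (hgt : ∀ x ∈ Set.Ioo (-1 : ℝ) 1, θ < x →
      t * ((α + α ^ 2 / 2) * (1 - x) / (1 + (α + α ^ 2 / 2) * (1 - x))) < l) :
    Tendsto (fun N : ℕ => (Matrix.of fun i j : Fin m =>
        K α (n N) (r N i) (a i) (s i) (r N j) (a j) (s j)).det) atTop
      (𝓝 (((Matrix.of fun i j : Fin m =>
        L (d i) (a i) (s i) (d j) (a j) (s j) θ).det : ℝ) : ℂ)) := by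
  have e : (((Matrix.of fun i j : Fin m =>
        L (d i) (a i) (s i) (d j) (a j) (s j) θ).det : ℝ) : ℂ)
      = (Matrix.of fun i j : Fin m =>
        ((L (d i) (a i) (s i) (d j) (a j) (s j) θ : ℝ) : ℂ)).det :=
    Complex.ofRealHom.map_det _
  rw [e]
  simp only [Matrix.det_apply, Matrix.of_apply]
  exact tendsto_finsetSum _ fun σ _ => Tendsto.const_smul (tendsto_finsetProd _ fun i _ =>
    tendsto_K hα hl hn (hr i) (fun N => hd N _ i) _ _ _ _ hθ hlt hgt) _

end DiscreteJacobi

/-! ### Locating the switch point -/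

theorem mainTheorem2 (α : ℝ) (hα : 0 ≤ α) (t l : ℝ) (ht : 0 < t) (hl : 0 < l)
    (n : ℕ → ℕ) (hn : Tendsto (fun N : ℕ => (n N : ℝ) / (N : ℝ)) atTop (𝓝 t))
    (m : ℕ) (r : ℕ → Fin m → ℕ)
    (hr : ∀ i, Tendsto (fun N : ℕ => (r N i : ℝ) / (N : ℝ)) atTop (𝓝 l))
    (d : Fin m → ℤ) (hd : ∀ N i j, (r N i : ℤ) - (r N j : ℤ) = d i - d j)
    (a : Fin m → DiscreteJacobi.HalfSign) (s : Fin m → ℕ) :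
    ((1 - ((1 + α) ^ 2)⁻¹) * t ≤ l →
      Function.Injective (fun i => (d i, a i, s i)) →
      Tendsto (fun N : ℕ => (Matrix.of fun i j : Fin m =>
          DiscreteJacobi.K α (n N) (r N i) (a i) (s i) (r N j) (a j) (s j)).det)
        atTop (𝓝 1)) ∧
    (l < (1 - ((1 + α) ^ 2)⁻¹) * t →
      DiscreteJacobi.theta α t l ∈ Set.Ioo (-1 : ℝ) 1 ∧
      Tendsto (fun N : ℕ => (Matrix.of fun i j : Fin m =>
          DiscreteJacobi.K α (n N) (r N i) (a i) (s i) (r N j) (a j) (s j)).det)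
        atTop (𝓝 (((Matrix.of fun i j : Fin m =>
          DiscreteJacobi.L (d i) (a i) (s i) (d j) (a j) (s j)
            (DiscreteJacobi.theta α t l)).det : ℝ) : ℂ))) := by
  have hsq : (1 + α) ^ 2 = 1 + 2 * (α + α ^ 2 / 2) := by ring
  have hc : 0 ≤ α + α ^ 2 / 2 := by positivity
  rw [DiscreteJacobi.theta, show 2 * α + α ^ 2 = 2 * (α + α ^ 2 / 2) by ring, hsq,
    show (1 - (1 + 2 * (α + α ^ 2 / 2))⁻¹) * t
      = 2 * (α + α ^ 2 / 2) * t / (1 + 2 * (α + α ^ 2 / 2)) by field_simp; ring]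
  have htd := @DiscreteJacobi.tendsto_det_K α t l hα hl n hn m r hr d hd a s
  generalize α + α ^ 2 / 2 = c at hc htd ⊢
  constructor
  · intro h hinj
    rw [div_le_iff₀ (by positivity)] at h
    -- Nothing lies to the left of -1. To the right, t p(x) < l is strict even when l equals the
    -- threshold t p(-1), because l(1+x) > 0.
    have hlim := htd (θ := -1) (by norm_num) (fun x hx h => absurd hx.1 h.not_gt)
      fun x hx _ => by
        have hy : 0 < 1 - x := by linarith [hx.2]
        rw [← mul_div_assoc, div_lt_iff₀ (by positivity)]
        nlinarith [mul_le_mul_of_nonneg_right h hy.le, mul_pos hl (show 0 < 1 + x by linarith [hx.1])]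
    rwa [DiscreteJacobi.det_L_neg_one d a s hinj, Complex.ofReal_one] at hlim
  · intro h
    rw [lt_div_iff₀ (by positivity)] at h
    have hc0 : 0 < c := by
      refine lt_of_le_of_ne hc fun h0 => ?_
      subst h0
      linarith
    have htl : 0 < t - l := by nlinarith
    have hp : 0 < (t - l) * c := mul_pos htl hc0
    set θ := 1 + 2 * l / ((l - t) * (2 * c)) with hθ
    -- This is t p(θ) = l with denominators cleared.
    have key : (t - l) * c * (1 - θ) = l := by
      have : l - t ≠ 0 := by linarith
      rw [hθ]
      field_simp
      ring
    have hmem : θ ∈ Set.Ioo (-1 : ℝ) 1 := by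
      -- By `key`, 1-θ > 0, and 1-θ < 2 amounts to l < 2c(t-l), which is the case hypothesis.
      constructor <;> nlinarith
    refine ⟨hmem, htd (Set.Ioo_subset_Icc_self hmem) (fun x hx hxθ => ?_) fun x hx hxθ => ?_⟩
    · have hy : 0 < 1 - x := by linarith [hx.2]
      rw [← mul_div_assoc, lt_div_iff₀ (by positivity)]
      nlinarith [mul_lt_mul_of_pos_left hxθ hp]
    · have hy : 0 < 1 - x := by linarith [hx.2]
      rw [← mul_div_assoc, div_lt_iff₀ (by positivity)]
      nlinarith [mul_lt_mul_of_pos_left hxθ hp]
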